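/- **Square-root increase of QEM inaccuracy.** Let $n\ge 0$ and $N_{\rm G}\ge 0$ be integers, and let $S_i$ ($i=1,\dots,4^n$) be the $n$-qubit Pauli operators. Represent an operator $X$ by the vector with entries $2^{-n/2}\operatorname{tr}(S_iX)$ and a linear map $\Phi$ on operators by its Pauli transfer matrix, with entries $2^{-n}\operatorname{tr}(S_i\Phi(S_j))$. Consider a circuit with initial state $(|0\rangle\langle 0|)^{\otimes n}$ (vector $v_0$), ideal unitary gates with Pauli transfer matrices $G_1,\dots,G_{N_{\rm G}}$, and an observable $M_{\rm ob}$ (Hermitian, eigenvalues in $[-1,1]$, vector $v_{\rm ob}$). Its error-free result is $\tilde r=v_{\rm ob}^{\rm T}G_{N_{\rm G}}\cdots G_1v_0$. The $k$-th gate is followed by a completely positive trace-preserving channel $C_k$ which is invertible with $C_k^{-1}=\sum_{l=1}^{L}\alpha^{(k)}_lO_l$, where the $\alpha^{(k)}_l$ are real and the $O_l$ are completely positive trace-nonincreasing maps. For each $k$ one draws $N_k\ge N_{\rm s}\|\alpha_k\|_1^2$ labels $l_{1,k},\dots,l_{N_k,k}$ from the distribution $p^{(k)}_l=|\alpha^{(k)}_l|/\|\alpha_k\|_1$,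 where $N_{\rm s}>0$; all labels, within a gate and across gates, are independent. Put $$\Gamma_k=\frac{\|\alpha_k\|_1}{N_k}\sum_{i=1}^{N_k}\operatorname{sgn}\bigl(\alpha^{(k)}_{l_{i,k}}\bigr)O_{l_{i,k}},\qquad v_k=\Gamma_kC_kG_kv_{k-1},\qquad r=v_{\rm ob}^{\rm T}v_{N_{\rm G}}.$$ Then $(r-\tilde r)^2$ is integrable and $$\sqrt{\mathbb E\{(r-\tilde r)^2\}}\le 2^{n/2}\sqrt{\exp(2N_{\rm G}/N_{\rm s})-1}.$$ In particular, the bound holds for Pauli channels $C_k(\rho)=\sum_i q^{(k)}_iS_i\rho S_i$, where $q_k$ is a probability vector, when $O_i(\rho)=S_i\rho S_i$ and $\alpha_k=4^{-n}H(1/c_k)$. Here $H$ is the $4^n\times4^n$ matrix whose $(i,j)$ entry is $1$ if $S_i$ and $S_j$ commute and $-1$ if they anticommute, $c_k=Hq_k$ is assumed to have no zero entry, and $1/c_k$ is taken entrywise. -/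

import Mathlib

open scoped Matrix ComplexOrder
open MeasureTheory ProbabilityTheory

noncomputable section

namespace QEM

/-- Operators on `n` qubits, as complex matrices in the computational basis (bit strings). -/
abbrev Op (n : ℕ) := Matrix (Fin n → Fin 2) (Fin n → Fin 2) ℂ

/-- Linear maps from operators to operators. -/
abbrev SuperOp (n : ℕ) := Op n →ₗ[ℂ] Op n

/-- Labels of the `4 ^ n` Pauli operators on `n` qubits; `0, 1, 2, 3` stand for `I, X, Y, Z`. -/
abbrev PauliIdx (n : ℕ) := Fin n → Fin 4

/-! ### Quantum operations -/

/-- The map `ρ ↦ K ρ Kᴴ`. -/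
def conj {n : ℕ} (K : Op n) : SuperOp n where
  toFun ρ := K * ρ * Kᴴ
  map_add' ρ σ := by rw [mul_add, add_mul]
  map_smul' c ρ := by simp

/-- Complete positivity, through an operator-sum representation `ρ ↦ ∑ i, Eᵢ ρ Eᵢᴴ`. -/
def IsCP {n : ℕ} (Φ : SuperOp n) : Prop :=
  ∃ (m : ℕ) (E : Fin m → Op n), ∀ ρ : Op n, Φ ρ = ∑ i, E i * ρ * (E i)ᴴ

/-- Completely positive and trace preserving: an operator-sum representation satisfying the
completeness condition `∑ i, Eᵢᴴ Eᵢ = 1`. -/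
def IsCPTP {n : ℕ} (Φ : SuperOp n) : Prop :=
  ∃ (m : ℕ) (E : Fin m → Op n),
    (∀ ρ : Op n, Φ ρ = ∑ i, E i * ρ * (E i)ᴴ) ∧ ∑ i, (E i)ᴴ * E i = 1

/-- The trace of a positive semidefinite operator does not increase. -/
def IsTraceNonincreasing {n : ℕ} (Φ : SuperOp n) : Prop :=
  ∀ ρ : Op n, ρ.PosSemidef → (Φ ρ).trace.re ≤ ρ.trace.re

/-! ### Pauli operators and the Pauli transfer matrix representation -/

/-- The single-qubit Pauli matrices `I, X, Y, Z`. -/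
def pauli1 : Fin 4 → Matrix (Fin 2) (Fin 2) ℂ :=
  ![!![1, 0; 0, 1], !![0, 1; 1, 0], !![0, -Complex.I; Complex.I, 0], !![1, 0; 0, -1]]

/-- The Pauli operator `S_i` on `n` qubits: the tensor product of the matrices `pauli1 (i q)`. -/
def pauli {n : ℕ} (i : PauliIdx n) : Op n :=
  Matrix.of fun a b => ∏ q, pauli1 (i q) (a q) (b q)

/-- Vector representation of an operator, with entries `2^{-n/2} tr (S_i X)`. These numbers are
real for Hermitian `X`, so taking real parts only fixes the type. -/
def ptmVec {n : ℕ} (X : Op n) : PauliIdx n → ℝ :=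
  fun i => (1 / Real.sqrt (2 ^ n)) * (pauli i * X).trace.re

/-- Pauli transfer matrix of a map, with entries `2^{-n} tr (S_i Φ(S_j))`. These numbers are real
for maps that preserve Hermiticity, so taking real parts only fixes the type. -/
def ptm {n : ℕ} (Φ : SuperOp n) : Matrix (PauliIdx n) (PauliIdx n) ℝ :=
  Matrix.of fun i j => (1 / 2 ^ n) * (pauli i * Φ (pauli j)).trace.re

/-- The initial state `(|0⟩⟨0|)^{⊗ n}`. -/
def initState (n : ℕ) : Op n := Matrix.single 0 0 1

/-! ### Monte Carlo channel inversion -/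

/-- `‖α‖₁`. -/
def l1 {ι : Type*} [Fintype ι] (α : ι → ℝ) : ℝ := ∑ l, |α l|

/-- The Pauli transfer matrix of the approximate inverse obtained from the sampled labels
`s 0, …, s (N - 1)`: the matrix `Γ = (‖α‖₁ / N) ∑ i, sgn (α (s i)) O_{s i}`. -/
def approxInverse {n : ℕ} {ι : Type*} [Fintype ι] (O : ι → SuperOp n) (α : ι → ℝ) {N : ℕ}
    (s : Fin N → ι) : Matrix (PauliIdx n) (PauliIdx n) ℝ :=
  (l1 α / N) • ∑ i, Real.sign (α (s i)) • ptm (O (s i))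

/-- The vectors `v_0, …, v_{N_G}`, where `v_0` represents the initial state and
`v_{k+1} = T_k v_k` (the gates are numbered from `0`). -/
def stateVec {n NG : ℕ} (T : Fin NG → Matrix (PauliIdx n) (PauliIdx n) ℝ) :
    Fin (NG + 1) → PauliIdx n → ℝ :=
  Fin.induction (motive := fun _ => PauliIdx n → ℝ) (ptmVec (initState n)) fun k v => T k *ᵥ v

/-- The error-free computational result. -/
def idealResult {n NG : ℕ} (M : Op n) (U : Fin NG → Op n) : ℝ :=
  ptmVec M ⬝ᵥ stateVec (fun k => ptm (conj (U k))) (Fin.last NG)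

/-- The computational result of the protected circuit for given sampled labels `s k i`: the `k`-th
step applies the gate `G_k`, then the residual channel `Γ_k C_k`. -/
def qemResult {n NG : ℕ} {ι : Type*} [Fintype ι] (M : Op n) (U : Fin NG → Op n)
    (C : Fin NG → SuperOp n) (O : ι → SuperOp n) (α : Fin NG → ι → ℝ) {N : Fin NG → ℕ}
    (s : ∀ k, Fin (N k) → ι) : ℝ :=
  ptmVec M ⬝ᵥ
    stateVec (fun k => (approxInverse O (α k) (s k) * ptm (C k)) * ptm (conj (U k))) (Fin.last NG)

/-- Monte Carlo sampling: for each gate `k`, the labels `ℓ k 0, …, ℓ k (N k - 1)` follow the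
distribution `p_l = |α_l| / ‖α‖₁` of that gate, and all the labels, within a gate and across
gates, are independent (so the counts for each gate are multinomial). -/
structure IsMonteCarlo {NG : ℕ} {ι Ω : Type*} [Fintype ι] [MeasurableSpace ι] [MeasurableSpace Ω]
    (P : Measure Ω) (α : Fin NG → ι → ℝ) (N : Fin NG → ℕ) (ℓ : ∀ k, Fin (N k) → Ω → ι) :
    Prop where
  measurable : ∀ k i, Measurable (ℓ k i)
  law : ∀ k i l, P.real (ℓ k i ⁻¹' {l}) = |α k l| / l1 (α k)
  indep : iIndepFun (fun (x : Σ k, Fin (N k)) => ℓ x.1 x.2) P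

/-! ### Pauli channels -/

/-- The Pauli channel `ρ ↦ ∑ i, q_i S_i ρ S_i` (the `S_i` are Hermitian). -/
def pauliChannel {n : ℕ} (q : PauliIdx n → ℝ) : SuperOp n :=
  ∑ i, (q i : ℂ) • conj (pauli i)

/-- The Hadamard transform over `n` qubits in the Pauli labelling: the entry at `(i, j)` is `1` if
`S_i` and `S_j` commute and `-1` if they anticommute. -/
def hadamard (n : ℕ) : Matrix (PauliIdx n) (PauliIdx n) ℝ :=
  Matrix.of fun i j => ∏ q, if i q = 0 ∨ j q = 0 ∨ i q = j q then 1 else -1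

/-- The quasi-probability vector of the inverse of a Pauli channel: `4^{-n} H (1 / c)` for the
vector `c = H q` of diagonal entries of its Pauli transfer matrix. -/
def pauliQuasiProb {n : ℕ} (q : PauliIdx n → ℝ) : PauliIdx n → ℝ :=
  ((1 : ℝ) / 4 ^ n) • (hadamard n *ᵥ fun i => 1 / (hadamard n *ᵥ q) i)

end QEM

end

namespace QEM

/-! ### Sums over finite product spaces -/

/-! The error is a variance computation that never tracks the unphysical, possibly non-positive
operators produced by a sampled inverse. Write `b` for a common bound on `‖α_k‖₁² / N_k`. The claim
proved by induction on the number of gates (`sum_sampled_sq_le`) is that, from any subnormalised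
state and for every real `a`, the mean square deviation of the sampled result from `a` exceeds that
of the ideal result by at most `(1 + b) ^ NG - 1`. Fix the labels of all gates but the first. The
result is then a quasi-probability sample mean of the numbers `f l`, the outcome of the remaining
circuit started in `O_l C ρ'`, with `ρ'` the state after the first ideal gate. Its mean is the
outcome started in `ρ'`, since the inverse is exact on average, and its variance is at most `b`
times a second moment of `f` (`sum_quasiProb_sq_le`). Averaging over the later labels uses the
induction hypothesis twice: at `ρ'` with the same `a`, and at each subnormalised state `O_l C ρ'`
with `a = 0`, where the ideal outcome is at most `1` in absolute value (`abs_trace_mul_le`). Taking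
`a` to be the ideal result and `b = 1 / Ns` gives mean square error at most `(1 + 1 / Ns) ^ NG - 1`,
which is stronger than the stated bound. For Pauli channels the Pauli operators are eigenvectors, so
inversion reduces to `H² = 4 ^ n`. -/

lemma sum_pi_fin_succ {NG : ℕ} {β : Fin (NG + 1) → Type*} [∀ k, Fintype (β k)]
    (F : (∀ k, β k) → ℝ) :
    ∑ s, F s = ∑ a : β 0, ∑ t : ∀ k : Fin NG, β k.succ, F (Fin.cons a t) := by
  rw [← (Fin.consEquiv β).sum_comp, Fintype.sum_prod_type]
  rfl

/-- Second moment of a shifted sum of i.i.d. samples of a finite distribution. -/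
lemma sum_prod_mul_add_sum_sq {ι : Type*} [Fintype ι] (p h : ι → ℝ) (hp : ∑ l, p l = 1) (N : ℕ)
    (c : ℝ) :
    ∑ s : Fin N → ι, (∏ i, p (s i)) * (c + ∑ i, h (s i)) ^ 2 =
      (c + N * ∑ l, p l * h l) ^ 2 + N * (∑ l, p l * h l ^ 2 - (∑ l, p l * h l) ^ 2) := by
  -- The shift `c` varies so that it can absorb the value of the first sample.
  induction N generalizing c with
  | zero => simp
  | succ N ih =>
    rw [sum_pi_fin_succ]
    simp only [Fin.prod_univ_succ, Fin.sum_univ_succ, Fin.cons_zero, Fin.cons_succ, ← add_assoc,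
      mul_assoc, ← Finset.mul_sum, ih]
    set μ := ∑ l, p l * h l
    set σ := ∑ l, p l * h l ^ 2
    have hsplit : ∀ l, p l * ((c + h l + N * μ) ^ 2 + N * (σ - μ ^ 2)) =
        p l * ((c + N * μ) ^ 2 + N * (σ - μ ^ 2)) + 2 * (c + N * μ) * (p l * h l)
          + p l * h l ^ 2 := fun l => by ring
    simp only [hsplit, Finset.sum_add_distrib, ← Finset.sum_mul, ← Finset.mul_sum, hp]
    push_cast
    ring

lemma sum_abs_div_l1 {ι : Type*} [Fintype ι] {α : ι → ℝ} (hα : l1 α ≠ 0) :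
    ∑ l, |α l| / l1 α = 1 := by
  rw [← Finset.sum_div]
  exact div_self hα

lemma l1_nonneg {ι : Type*} [Fintype ι] (α : ι → ℝ) : 0 ≤ l1 α :=
  Finset.sum_nonneg fun _ _ => abs_nonneg _

/-- Quasi-probability sampling of `∑ l, α l * f l`: the mean square deviation from any number `a`
exceeds that of the mean by at most `‖α‖₁² / N` times a second moment of `f`. -/
lemma sum_quasiProb_sq_le {ι : Type*} [Fintype ι] {α : ι → ℝ} (hα : l1 α ≠ 0) {N : ℕ} (hN : N ≠ 0)
    (f : ι → ℝ) (a : ℝ) :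
    ∑ s : Fin N → ι, (∏ i, |α (s i)| / l1 α) *
        ((l1 α / N) * (∑ i, Real.sign (α (s i)) * f (s i)) - a) ^ 2 ≤
      (∑ l, α l * f l - a) ^ 2 + l1 α ^ 2 / N * ∑ l, |α l| / l1 α * f l ^ 2 := by
  have hN' : (N : ℝ) ≠ 0 := Nat.cast_ne_zero.2 hN
  have hN0 : (0 : ℝ) < N := Nat.cast_pos.2 (Nat.pos_of_ne_zero hN)
  -- Pulling out the scale `l1 α / N` turns the deviation from `a` into a sum shifted by `-(a * N /
  -- l1 α)`.
  have hkey : ∀ s : Fin N → ι, (∏ i, |α (s i)| / l1 α) *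
        ((l1 α / N) * (∑ i, Real.sign (α (s i)) * f (s i)) - a) ^ 2 =
      (l1 α / N) ^ 2 * ((∏ i, |α (s i)| / l1 α) *
        (-(a * N / l1 α) + ∑ i, Real.sign (α (s i)) * f (s i)) ^ 2) := fun s => by
    field_simp
    ring
  have hμ : ∑ l, |α l| / l1 α * (Real.sign (α l) * f l) = (∑ l, α l * f l) / l1 α := by
    rw [Finset.sum_div]
    refine Finset.sum_congr rfl fun l _ => ?_
    have : |α l| * Real.sign (α l) = α l := by
      rcases lt_trichotomy (α l) 0 with h | h | h
      · rw [Real.sign_of_neg h, abs_of_neg h]; ring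
      · simp [h]
      · rw [Real.sign_of_pos h, abs_of_pos h, mul_one]
    rw [div_mul_eq_mul_div, ← mul_assoc, this]
  have hσ : ∑ l, |α l| / l1 α * (Real.sign (α l) * f l) ^ 2 ≤ ∑ l, |α l| / l1 α * f l ^ 2 := by
    refine Finset.sum_le_sum fun l _ => ?_
    refine mul_le_mul_of_nonneg_left ?_ (div_nonneg (abs_nonneg _) (l1_nonneg α))
    rcases Real.sign_apply_eq (α l) with h | h | h <;> rw [h] <;> simp [sq_nonneg]
  rw [Finset.sum_congr rfl fun s _ => hkey s, ← Finset.mul_sum,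
    sum_prod_mul_add_sum_sq _ (fun l => Real.sign (α l) * f l) (sum_abs_div_l1 hα), hμ]
  set g := ∑ l, α l * f l
  set σ := ∑ l, |α l| / l1 α * (Real.sign (α l) * f l) ^ 2
  -- The exact variance contains `- g ^ 2 / N`, which is dropped at the end.
  have h1 : (l1 α / N) ^ 2 * ((-(a * N / l1 α) + N * (g / l1 α)) ^ 2 + N * (σ - (g / l1 α) ^ 2)) =
      (g - a) ^ 2 + l1 α ^ 2 / N * σ - g ^ 2 / N := by
    field_simp
    ring
  rw [h1]
  have h2 := mul_le_mul_of_nonneg_left hσ (by positivity : 0 ≤ l1 α ^ 2 / N)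
  have h3 : 0 ≤ g ^ 2 / N := by positivity
  linarith

/-- Expectations over Monte Carlo labels are finite sums. -/
lemma IsMonteCarlo.integrable_and_integral_eq {NG : ℕ} {ι Ω : Type*} [Fintype ι]
    [MeasurableSpace ι] [MeasurableSingletonClass ι] [MeasurableSpace Ω] {P : Measure Ω}
    [IsProbabilityMeasure P] {α : Fin NG → ι → ℝ} {N : Fin NG → ℕ} {ℓ : ∀ k, Fin (N k) → Ω → ι}
    (h : IsMonteCarlo P α N ℓ) (F : (∀ k, Fin (N k) → ι) → ℝ) :
    Integrable (fun ω => F fun k i => ℓ k i ω) P ∧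
      ∫ ω, F (fun k i => ℓ k i ω) ∂P =
        ∑ s : ∀ k, Fin (N k) → ι, (∏ k, ∏ i, |α k (s k i)| / l1 (α k)) * F s := by
  classical
  have hX : Measurable fun ω => (fun k i => ℓ k i ω : ∀ k, Fin (N k) → ι) :=
    measurable_pi_iff.2 fun k => measurable_pi_iff.2 fun i => h.measurable k i
  have := Measure.isProbabilityMeasure_map (μ := P) hX.aemeasurable
  have hF : Integrable F (P.map fun ω => (fun k i => ℓ k i ω : ∀ k, Fin (N k) → ι)) := .of_finite
  refine ⟨hF.comp_measurable hX, ?_⟩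
  rw [← integral_map hX.aemeasurable hF.aestronglyMeasurable, integral_fintype hF]
  refine Finset.sum_congr rfl fun s _ => ?_
  rw [smul_eq_mul]
  congr 1
  rw [measureReal_def, Measure.map_apply hX (measurableSet_singleton s)]
  have hset : (fun ω => (fun k i => ℓ k i ω : ∀ k, Fin (N k) → ι)) ⁻¹' {s} =
      ⋂ x ∈ (Finset.univ : Finset (Σ k, Fin (N k))), ℓ x.1 x.2 ⁻¹' {s x.1 x.2} := by
    ext ω
    simp [funext_iff, Sigma.forall]
  rw [hset, h.indep.measure_inter_preimage_eq_mul Finset.univ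
    (sets := fun x => {s x.1 x.2}) (fun _ _ => measurableSet_singleton _), ENNReal.toReal_prod,
    Fintype.prod_sigma]
  exact Finset.prod_congr rfl fun k _ => Finset.prod_congr rfl fun i _ => h.law k i _

/-! ### Tensor products of single-qubit matrices -/

lemma prod_sum_fin {n : ℕ} {κ R : Type*} [Fintype κ] [CommSemiring R] (f : Fin n → κ → R) :
    ∑ c : Fin n → κ, ∏ q, f q (c q) = ∏ q, ∑ x, f q x := by
  classical
  rw [Finset.prod_univ_sum, Fintype.piFinset_univ]

lemma of_prod_mul {n : ℕ} (A B : Fin n → Matrix (Fin 2) (Fin 2) ℂ) :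
    (Matrix.of fun a b => ∏ q, A q (a q) (b q) : Op n) * (Matrix.of fun a b => ∏ q, B q (a q) (b q))
      = Matrix.of fun a b => ∏ q, (A q * B q) (a q) (b q) := by
  ext a b
  simp only [Matrix.mul_apply, Matrix.of_apply, ← Finset.prod_mul_distrib]
  exact prod_sum_fin fun q x => A q (a q) x * B q x (b q)

lemma pauli1_isHermitian (i : Fin 4) : (pauli1 i).IsHermitian := by
  ext a b
  fin_cases i <;> fin_cases a <;> fin_cases b <;> simp [pauli1]

lemma pauli1_mul_self (i : Fin 4) : pauli1 i * pauli1 i = 1 := by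
  ext a b
  fin_cases i <;> fin_cases a <;> fin_cases b <;>
    simp [pauli1, Matrix.mul_apply, Fin.sum_univ_two]

lemma pauli1_conj (i j : Fin 4) : pauli1 i * pauli1 j * pauli1 i =
    (if i = 0 ∨ j = 0 ∨ i = j then (1 : ℂ) else -1) • pauli1 j := by
  ext a b
  fin_cases i <;> fin_cases j <;> fin_cases a <;> fin_cases b <;>
    simp [pauli1, Matrix.mul_apply, Fin.sum_univ_two]

/-- The sum of `S ⊗ S` over the one-qubit Pauli matrices is twice the swap operator; its tensor
power gives completeness on `n` qubits. -/
lemma sum_pauli1_mul_pauli1 (a b c d : Fin 2) :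
    ∑ i, pauli1 i a b * pauli1 i c d = if a = d ∧ b = c then 2 else 0 := by
  fin_cases a <;> fin_cases b <;> fin_cases c <;> fin_cases d <;>
    simp [pauli1, Fin.sum_univ_four] <;> norm_num

lemma pauli_isHermitian {n : ℕ} (i : PauliIdx n) : (pauli i).IsHermitian := by
  ext a b
  simp only [pauli, Matrix.conjTranspose_apply, Matrix.of_apply, star_prod]
  exact Finset.prod_congr rfl fun q _ => (pauli1_isHermitian (i q)).apply _ _

lemma pauli_mul_self {n : ℕ} (i : PauliIdx n) : pauli i * pauli i = 1 := by
  rw [pauli, of_prod_mul]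
  ext a b
  simp only [pauli1_mul_self, Matrix.of_apply, Matrix.one_apply, Finset.prod_ite_zero,
    Finset.prod_const_one, Finset.mem_univ, true_implies, funext_iff]

lemma pauli_conj {n : ℕ} (i j : PauliIdx n) :
    pauli i * pauli j * pauli i = (hadamard n i j : ℂ) • pauli j := by
  rw [pauli, pauli, of_prod_mul, of_prod_mul]
  ext a b
  simp only [pauli1_conj, hadamard, Matrix.of_apply, Matrix.smul_apply, smul_eq_mul,
    Finset.prod_mul_distrib, Complex.ofReal_prod]
  congr 1
  refine Finset.prod_congr rfl fun q _ => ?_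
  split_ifs <;> simp

lemma sum_pauli_mul_pauli {n : ℕ} (a b c d : Fin n → Fin 2) :
    ∑ i : PauliIdx n, pauli i a b * pauli i c d = if a = d ∧ b = c then 2 ^ n else 0 := by
  simp only [pauli, Matrix.of_apply, ← Finset.prod_mul_distrib]
  rw [prod_sum_fin fun q x => pauli1 x (a q) (b q) * pauli1 x (c q) (d q)]
  simp only [sum_pauli1_mul_pauli1, Finset.prod_ite_zero, Finset.prod_const, Finset.card_univ,
    Fintype.card_fin, Finset.mem_univ, true_implies, funext_iff, forall_and]

/-- Completeness of the Pauli operators. -/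
lemma sum_trace_pauli_smul {n : ℕ} (X : Op n) :
    ∑ i : PauliIdx n, (pauli i * X).trace • pauli i = (2 : ℂ) ^ n • X := by
  ext a b
  have : ∀ i : PauliIdx n, (pauli i * X).trace * pauli i a b =
      ∑ c, ∑ d, X d c * (pauli i c d * pauli i a b) := fun i => by
    simp only [Matrix.trace, Matrix.diag, Matrix.mul_apply, Finset.sum_mul]
    exact Finset.sum_congr rfl fun _ _ => Finset.sum_congr rfl fun _ _ => by ring
  simp only [Matrix.sum_apply, Matrix.smul_apply, smul_eq_mul, this]
  rw [Finset.sum_comm]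
  simp_rw [Finset.sum_comm (s := (Finset.univ : Finset (PauliIdx n))), ← Finset.mul_sum,
    sum_pauli_mul_pauli, ite_and]
  simp [mul_comm]

lemma superOp_ext {n : ℕ} {Φ Ψ : SuperOp n} (h : ∀ i, Φ (pauli i) = Ψ (pauli i)) : Φ = Ψ := by
  ext1 X
  have h2 : (2 : ℂ) ^ n ≠ 0 := by positivity
  have hX : (2 : ℂ) ^ n • Φ X = (2 : ℂ) ^ n • Ψ X := by
    rw [← map_smul, ← map_smul, ← sum_trace_pauli_smul]
    simp [h]
  exact smul_right_injective _ h2 hX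

/-! ### The Pauli transfer matrix representation -/

lemma trace_pauli_mul_im {n : ℕ} (i : PauliIdx n) {X : Op n} (hX : X.IsHermitian) :
    (pauli i * X).trace.im = 0 := by
  rw [← Complex.conj_eq_iff_im]
  change star _ = _
  rw [← Matrix.trace_conjTranspose, Matrix.conjTranspose_mul, hX.eq, (pauli_isHermitian i).eq,
    Matrix.trace_mul_comm]

lemma sqrt_two_pow_sq (n : ℕ) : (1 / Real.sqrt (2 ^ n)) * (1 / Real.sqrt (2 ^ n)) = 1 / 2 ^ n := by
  rw [div_mul_div_comm, one_mul, Real.mul_self_sqrt (by positivity)]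

/-- The Pauli coefficients of a Hermitian `X` are real, so real parts pass through the products even
when `f (pauli i)` is complex. Suitable choices of `f` yield both the pairing of vectors and the
action of transfer matrices. -/
lemma sum_trace_pauli_re {n : ℕ} (f : Op n →ₗ[ℂ] ℂ) {X : Op n} (hX : X.IsHermitian) :
    (1 / 2 ^ n) * ∑ i : PauliIdx n, (f (pauli i)).re * (pauli i * X).trace.re = (f X).re := by
  have h := congrArg (fun Y => (f Y).re) (sum_trace_pauli_smul X)
  have h2 : ((2 : ℂ) ^ n) = ((2 ^ n : ℝ) : ℂ) := by push_cast; rfl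
  simp only [map_sum, map_smul, smul_eq_mul, h2, Complex.re_sum,
    Complex.mul_re, trace_pauli_mul_im _ hX, zero_mul, sub_zero, Complex.ofReal_re,
    Complex.ofReal_im] at h
  rw [Finset.sum_congr rfl fun i _ => mul_comm (f (pauli i)).re _, h]
  field_simp

lemma ptmVec_dotProduct {n : ℕ} (M : Op n) {X : Op n} (hX : X.IsHermitian) :
    ptmVec M ⬝ᵥ ptmVec X = (M * X).trace.re := by
  have h := sum_trace_pauli_re ((Matrix.traceLinearMap _ ℂ ℂ) ∘ₗ LinearMap.mulLeft ℂ M) hX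
  simp only [LinearMap.comp_apply, LinearMap.mulLeft_apply, Matrix.traceLinearMap_apply] at h
  rw [← h, dotProduct, Finset.mul_sum]
  refine Finset.sum_congr rfl fun i _ => ?_
  rw [← sqrt_two_pow_sq]
  simp only [ptmVec, Matrix.trace_mul_comm (pauli i) M]
  ring

lemma ptm_mulVec_ptmVec {n : ℕ} (Φ : SuperOp n) {X : Op n} (hX : X.IsHermitian) :
    ptm Φ *ᵥ ptmVec X = ptmVec (Φ X) := by
  ext i
  simp only [ptmVec]
  have := sum_trace_pauli_re
    ((Matrix.traceLinearMap _ ℂ ℂ) ∘ₗ LinearMap.mulLeft ℂ (pauli i) ∘ₗ Φ) hX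
  simp only [LinearMap.comp_apply, LinearMap.mulLeft_apply, Matrix.traceLinearMap_apply] at this
  rw [← this, Finset.mul_sum, Finset.mul_sum, Matrix.mulVec, dotProduct]
  refine Finset.sum_congr rfl fun j _ => ?_
  simp only [ptm, ptmVec, Matrix.of_apply]
  ring

lemma ptmVec_sum_smul {n : ℕ} {ι : Type*} [Fintype ι] (α : ι → ℝ) (X : ι → Op n) :
    ptmVec (∑ l, (α l : ℂ) • X l) = ∑ l, α l • ptmVec (X l) := by
  ext i
  simp only [ptmVec, Matrix.trace_sum, Complex.re_sum, Finset.sum_apply,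
    Pi.smul_apply, smul_eq_mul, Finset.mul_sum, Matrix.mul_smul, Matrix.trace_smul,
    Complex.re_ofReal_mul]
  exact Finset.sum_congr rfl fun _ _ => by ring

/-! ### Subnormalised states -/

/-- Positive semidefinite operators of trace at most one. -/
def IsSubstate {n : ℕ} (ρ : Op n) : Prop := ρ.PosSemidef ∧ ρ.trace.re ≤ 1

lemma IsCP.posSemidef {n : ℕ} {Φ : SuperOp n} (h : IsCP Φ) {ρ : Op n} (hρ : ρ.PosSemidef) :
    (Φ ρ).PosSemidef := by
  obtain ⟨m, E, hE⟩ := h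
  rw [hE]
  exact Matrix.posSemidef_sum _ fun i _ => hρ.mul_mul_conjTranspose_same _

lemma IsCP.isSubstate {n : ℕ} {Φ : SuperOp n} (h : IsCP Φ) (h' : IsTraceNonincreasing Φ)
    {ρ : Op n} (hρ : IsSubstate ρ) : IsSubstate (Φ ρ) :=
  ⟨h.posSemidef hρ.1, (h' ρ hρ.1).trans hρ.2⟩

lemma IsCPTP.isCP {n : ℕ} {Φ : SuperOp n} (h : IsCPTP Φ) : IsCP Φ :=
  let ⟨m, E, hE, _⟩ := h; ⟨m, E, hE⟩

lemma IsCPTP.trace_eq {n : ℕ} {Φ : SuperOp n} (h : IsCPTP Φ) (ρ : Op n) :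
    (Φ ρ).trace = ρ.trace := by
  obtain ⟨m, E, hE, hE1⟩ := h
  rw [hE, Matrix.trace_sum, Finset.sum_congr rfl fun i _ =>
    Matrix.trace_mul_cycle (E i) ρ (E i)ᴴ, ← Matrix.trace_sum, ← Finset.sum_mul, hE1, one_mul]

lemma IsCPTP.isTraceNonincreasing {n : ℕ} {Φ : SuperOp n} (h : IsCPTP Φ) :
    IsTraceNonincreasing Φ := fun ρ _ => by rw [h.trace_eq]

lemma isCPTP_conj {n : ℕ} {V : Op n} (hV : V ∈ Matrix.unitaryGroup (Fin n → Fin 2) ℂ) :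
    IsCPTP (conj V) :=
  ⟨1, fun _ => V, fun ρ => by simp [conj], by
    simpa [Matrix.star_eq_conjTranspose] using Matrix.mem_unitaryGroup_iff'.1 hV⟩

lemma isSubstate_initState (n : ℕ) : IsSubstate (initState n) := by
  refine ⟨?_, by simp [initState]⟩
  have : initState n = Matrix.diagonal (Pi.single 0 1) := by
    rw [initState, Matrix.diagonal_single]
  rw [this, Matrix.posSemidef_diagonal_iff]
  intro a
  by_cases h : a = 0
  · subst h; simp
  · simp [h]

/-- In an eigenbasis of `M` the diagonal of `ρ` is nonnegative with sum at most one, and it weights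
eigenvalues in `[-1, 1]`. -/
lemma abs_trace_mul_le {n : ℕ} {M : Op n} (hM : M.IsHermitian)
    (hM1 : ∀ a, hM.eigenvalues a ∈ Set.Icc (-1 : ℝ) 1) {ρ : Op n} (hρ : IsSubstate ρ) :
    |(M * ρ).trace.re| ≤ 1 := by
  set V : Op n := (hM.eigenvectorUnitary : Op n) with hV
  set D : Op n := Matrix.diagonal (RCLike.ofReal ∘ hM.eigenvalues) with hD
  have hVV : V * Vᴴ = 1 := by
    simpa [Matrix.star_eq_conjTranspose] using
      Matrix.mem_unitaryGroup_iff.1 hM.eigenvectorUnitary.2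
  have hspec : M = V * D * Vᴴ := by
    conv_lhs => rw [hM.spectral_theorem, Unitary.conjStarAlgAut_apply]
    rfl
  have hpsd : (Vᴴ * ρ * V).PosSemidef := hρ.1.conjTranspose_mul_mul_same V
  have htr : (Vᴴ * ρ * V).trace = ρ.trace := by
    rw [Matrix.trace_mul_cycle, hVV, one_mul]
  have hMtr : (M * ρ).trace = (D * (Vᴴ * ρ * V)).trace := by
    rw [hspec, Matrix.trace_mul_comm D, Matrix.mul_assoc, Matrix.mul_assoc, Matrix.trace_mul_comm V]
    simp only [Matrix.mul_assoc]
    rw [Matrix.trace_mul_comm D]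
    simp only [Matrix.mul_assoc]
  have hdiag : ∀ a, 0 ≤ ((Vᴴ * ρ * V) a a).re := fun a =>
    (Complex.nonneg_iff.1 (hpsd.diag_nonneg (i := a))).1
  rw [hMtr]
  calc |(D * (Vᴴ * ρ * V)).trace.re|
      = |∑ a, hM.eigenvalues a * ((Vᴴ * ρ * V) a a).re| := by
        simp [hD, Matrix.trace, Matrix.diagonal_mul]
    _ ≤ ∑ a, |hM.eigenvalues a * ((Vᴴ * ρ * V) a a).re| := Finset.abs_sum_le_sum_abs _ _
    _ ≤ ∑ a, ((Vᴴ * ρ * V) a a).re := Finset.sum_le_sum fun a _ => by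
        rw [abs_mul, abs_of_nonneg (hdiag a)]
        exact mul_le_of_le_one_left (hdiag a) (abs_le.2 (hM1 a))
    _ = ρ.trace.re := by rw [← htr, Matrix.trace, Complex.re_sum]; rfl
    _ ≤ 1 := hρ.2

/-! ### Circuits -/

/-- The product `T_{N_G} ⋯ T_1` of the matrices of the successive steps. -/
def circuitMatrix {n : ℕ} : {NG : ℕ} → (Fin NG → Matrix (PauliIdx n) (PauliIdx n) ℝ) →
    Matrix (PauliIdx n) (PauliIdx n) ℝ
  | 0, _ => 1
  | _ + 1, T => circuitMatrix (fun k => T k.succ) * T 0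

/-- The recursion defining `stateVec` peels off the last gate, whereas the error estimate peels off
the first. -/
lemma induction_mulVec_succ {n NG : ℕ} (T : Fin (NG + 1) → Matrix (PauliIdx n) (PauliIdx n) ℝ)
    (x : PauliIdx n → ℝ) (i : Fin (NG + 1)) :
    Fin.induction (motive := fun _ => PauliIdx n → ℝ) x (fun k v => T k *ᵥ v) i.succ =
      Fin.induction (motive := fun _ => PauliIdx n → ℝ) (T 0 *ᵥ x) (fun k v => T k.succ *ᵥ v) i := by
  induction i using Fin.induction with
  | zero => rfl
  | succ i ih =>
    rw [Fin.induction_succ, Fin.induction_succ, ← ih]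
    rfl

lemma induction_mulVec_last {n NG : ℕ} (T : Fin NG → Matrix (PauliIdx n) (PauliIdx n) ℝ)
    (x : PauliIdx n → ℝ) :
    Fin.induction (motive := fun _ => PauliIdx n → ℝ) x (fun k v => T k *ᵥ v) (Fin.last NG) =
      circuitMatrix T *ᵥ x := by
  induction NG generalizing x with
  | zero => exact (Matrix.one_mulVec x).symm
  | succ NG ih =>
    rw [← Fin.succ_last, induction_mulVec_succ, ih, Matrix.mulVec_mulVec]
    rfl

lemma stateVec_last {n NG : ℕ} (T : Fin NG → Matrix (PauliIdx n) (PauliIdx n) ℝ) :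
    stateVec T (Fin.last NG) = circuitMatrix T *ᵥ ptmVec (initState n) :=
  induction_mulVec_last T _

lemma exists_circuitMatrix_mulVec_eq {n NG : ℕ} {U : Fin NG → Op n}
    (hU : ∀ k, U k ∈ Matrix.unitaryGroup (Fin n → Fin 2) ℂ) {ρ : Op n} (hρ : IsSubstate ρ) :
    ∃ σ : Op n, IsSubstate σ ∧
      circuitMatrix (fun k => ptm (conj (U k))) *ᵥ ptmVec ρ = ptmVec σ := by
  induction NG generalizing ρ with
  | zero => exact ⟨ρ, hρ, Matrix.one_mulVec _⟩
  | succ NG ih =>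
    have h0 := isCPTP_conj (hU 0)
    obtain ⟨σ, hσ, h⟩ := ih (fun k => hU k.succ) (h0.isCP.isSubstate h0.isTraceNonincreasing hρ)
    refine ⟨σ, hσ, ?_⟩
    rw [← h, circuitMatrix, ← Matrix.mulVec_mulVec, ptm_mulVec_ptmVec _ hρ.1.isHermitian]

lemma approxInverse_mulVec_ptmVec {n N : ℕ} {ι : Type*} [Fintype ι] (O : ι → SuperOp n)
    (α : ι → ℝ) (s : Fin N → ι) {X : Op n} (hX : X.IsHermitian) :
    approxInverse O α s *ᵥ ptmVec X =
      (l1 α / N) • ∑ i, Real.sign (α (s i)) • ptmVec (O (s i) X) := by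
  simp only [approxInverse, Matrix.smul_mulVec, Matrix.sum_mulVec, ptm_mulVec_ptmVec _ hX]

/-- Mean square deviation of the sampled circuit, started in `ρ`, from any number `a`. -/
lemma sum_sampled_sq_le {n NG : ℕ} {ι : Type*} [Fintype ι] {M : Op n} (hM : M.IsHermitian)
    (hM1 : ∀ a, hM.eigenvalues a ∈ Set.Icc (-1 : ℝ) 1) {U : Fin NG → Op n}
    (hU : ∀ k, U k ∈ Matrix.unitaryGroup (Fin n → Fin 2) ℂ)
    {O : ι → SuperOp n} (hO : ∀ l, IsCP (O l) ∧ IsTraceNonincreasing (O l))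
    {C : Fin NG → SuperOp n} (hC : ∀ k, IsCPTP (C k)) {α : Fin NG → ι → ℝ}
    (hinv : ∀ k, (∑ l, (α k l : ℂ) • O l) ∘ₗ C k = LinearMap.id) (hα : ∀ k, l1 (α k) ≠ 0)
    {N : Fin NG → ℕ} (hN : ∀ k, N k ≠ 0) {b : ℝ} (hb0 : 0 ≤ b)
    (hb : ∀ k, l1 (α k) ^ 2 / N k ≤ b) {ρ : Op n} (hρ : IsSubstate ρ) (a : ℝ) :
    ∑ s : ∀ k, Fin (N k) → ι, (∏ k, ∏ i, |α k (s k i)| / l1 (α k)) *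
        (ptmVec M ⬝ᵥ (circuitMatrix (fun k =>
          (approxInverse O (α k) (s k) * ptm (C k)) * ptm (conj (U k))) *ᵥ ptmVec ρ) - a) ^ 2 ≤
      (ptmVec M ⬝ᵥ (circuitMatrix (fun k => ptm (conj (U k))) *ᵥ ptmVec ρ) - a) ^ 2 +
        ((1 + b) ^ NG - 1) := by
  induction NG generalizing ρ a with
  | zero => simp [circuitMatrix]
  | succ NG ih =>
    set R : (∀ k : Fin NG, Fin (N k.succ) → ι) → Matrix (PauliIdx n) (PauliIdx n) ℝ := fun t =>
      circuitMatrix fun k =>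
        (approxInverse O (α k.succ) (t k) * ptm (C k.succ)) * ptm (conj (U k.succ)) with hR
    set I : Matrix (PauliIdx n) (PauliIdx n) ℝ :=
      circuitMatrix fun k : Fin NG => ptm (conj (U k.succ)) with hI
    set w : (∀ k : Fin NG, Fin (N k.succ) → ι) → ℝ := fun t =>
      ∏ k, ∏ i, |α k.succ (t k i)| / l1 (α k.succ) with hw
    have hw0 : ∀ t, 0 ≤ w t := fun t => Finset.prod_nonneg fun k _ => Finset.prod_nonneg
      fun i _ => div_nonneg (abs_nonneg _) (l1_nonneg _)
    have ih' : ∀ {ρ : Op n}, IsSubstate ρ → ∀ a : ℝ,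
        ∑ t, w t * (ptmVec M ⬝ᵥ (R t *ᵥ ptmVec ρ) - a) ^ 2 ≤
          (ptmVec M ⬝ᵥ (I *ᵥ ptmVec ρ) - a) ^ 2 + ((1 + b) ^ NG - 1) := fun hρ a =>
      ih (fun k => hU k.succ) (fun k => hC k.succ) (fun k => hinv k.succ) (fun k => hα k.succ)
        (fun k => hN k.succ) (fun k => hb k.succ) hρ a
    have hU0 := isCPTP_conj (hU 0)
    set ρ' := conj (U 0) ρ with hρ'_def
    have hρ' : IsSubstate ρ' := hU0.isCP.isSubstate hU0.isTraceNonincreasing hρ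
    have hσ : IsSubstate (C 0 ρ') := (hC 0).isCP.isSubstate (hC 0).isTraceNonincreasing hρ'
    have hτ : ∀ l, IsSubstate (O l (C 0 ρ')) := fun l => (hO l).1.isSubstate (hO l).2 hσ
    set f : (∀ k : Fin NG, Fin (N k.succ) → ι) → ι → ℝ := fun t l =>
      ptmVec M ⬝ᵥ (R t *ᵥ ptmVec (O l (C 0 ρ'))) with hf
    -- The sampled maps average to the exact inverse of `C 0`, so the estimator is unbiased for each
    -- fixed `t`.
    have hfmean : ∀ t, ∑ l, α 0 l * f t l = ptmVec M ⬝ᵥ (R t *ᵥ ptmVec ρ') := fun t => by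
      have h1 : ρ' = ∑ l, (α 0 l : ℂ) • O l (C 0 ρ') := by
        have := LinearMap.congr_fun (hinv 0) ρ'
        simpa using this.symm
      conv_rhs => rw [h1, ptmVec_sum_smul]
      simp only [hf, Matrix.mulVec_sum, Matrix.mulVec_smul, dotProduct_sum, dotProduct_smul,
        smul_eq_mul]
    have hstep : ∀ (s : Fin (N 0) → ι) t,
        ptmVec M ⬝ᵥ ((R t * ((approxInverse O (α 0) s * ptm (C 0)) * ptm (conj (U 0)))) *ᵥ
          ptmVec ρ) = (l1 (α 0) / N 0) * ∑ i, Real.sign (α 0 (s i)) * f t (s i) := fun s t => by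
      simp only [← Matrix.mulVec_mulVec, ptm_mulVec_ptmVec _ hρ.1.isHermitian]
      rw [ptm_mulVec_ptmVec _ hρ'.1.isHermitian, approxInverse_mulVec_ptmVec _ _ _ hσ.1.isHermitian]
      simp only [hf, Matrix.mulVec_sum, Matrix.mulVec_smul, dotProduct_sum, dotProduct_smul,
        smul_eq_mul]
    -- With `a = 0` the ideal term is the square of an expectation value in a subnormalised state,
    -- hence at most `1`, and cancels the `- 1`.
    have hsecond : ∀ l, ∑ t, w t * f t l ^ 2 ≤ (1 + b) ^ NG := fun l => by
      have h1 := ih' (hτ l) 0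
      obtain ⟨σ, hσ', hI'⟩ := exists_circuitMatrix_mulVec_eq (fun k : Fin NG => hU k.succ) (hτ l)
      rw [hI, hI', ptmVec_dotProduct _ hσ'.1.isHermitian] at h1
      have h2 := (sq_le_one_iff_abs_le_one _).2 (abs_trace_mul_le hM hM1 hσ')
      simp only [sub_zero] at h1
      linarith
    calc _ = ∑ t, w t * ∑ s : Fin (N 0) → ι, (∏ i, |α 0 (s i)| / l1 (α 0)) *
          ((l1 (α 0) / N 0) * (∑ i, Real.sign (α 0 (s i)) * f t (s i)) - a) ^ 2 := by
          rw [sum_pi_fin_succ, Finset.sum_comm]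
          refine Finset.sum_congr rfl fun t _ => ?_
          rw [Finset.mul_sum]
          refine Finset.sum_congr rfl fun s _ => ?_
          rw [← hstep, Fin.prod_univ_succ]
          simp only [circuitMatrix, Fin.cons_zero, Fin.cons_succ, hR, hw]
          ring
      _ ≤ ∑ t, w t * ((ptmVec M ⬝ᵥ (R t *ᵥ ptmVec ρ') - a) ^ 2 +
            l1 (α 0) ^ 2 / N 0 * ∑ l, |α 0 l| / l1 (α 0) * f t l ^ 2) := by
          refine Finset.sum_le_sum fun t _ => mul_le_mul_of_nonneg_left ?_ (hw0 t)
          rw [← hfmean]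
          exact sum_quasiProb_sq_le (hα 0) (hN 0) (f t) a
      _ = ∑ t, w t * (ptmVec M ⬝ᵥ (R t *ᵥ ptmVec ρ') - a) ^ 2 +
            l1 (α 0) ^ 2 / N 0 * ∑ l, |α 0 l| / l1 (α 0) * ∑ t, w t * f t l ^ 2 := by
          simp only [mul_add, Finset.sum_add_distrib, Finset.mul_sum]
          rw [Finset.sum_comm (γ := ι)]
          congr 1
          exact Finset.sum_congr rfl fun _ _ => Finset.sum_congr rfl fun _ _ => by ring
      _ ≤ ((ptmVec M ⬝ᵥ (I *ᵥ ptmVec ρ') - a) ^ 2 + ((1 + b) ^ NG - 1)) +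
            b * ∑ l, |α 0 l| / l1 (α 0) * (1 + b) ^ NG := by
          have hp : ∀ l, 0 ≤ |α 0 l| / l1 (α 0) := fun l =>
            div_nonneg (abs_nonneg _) (l1_nonneg _)
          refine add_le_add (ih' hρ' a) (mul_le_mul (hb 0) (Finset.sum_le_sum fun l _ =>
            mul_le_mul_of_nonneg_left (hsecond l) (hp l)) (Finset.sum_nonneg fun l _ =>
            mul_nonneg (hp l) (Finset.sum_nonneg fun t _ => mul_nonneg (hw0 t) (sq_nonneg _))) hb0)
      -- The recursion closes through `(1 + b) ^ NG - 1 + b * (1 + b) ^ NG = (1 + b) ^ (NG + 1) -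
      -- 1`.
      _ = _ := by
          rw [← Finset.sum_mul, sum_abs_div_l1 (hα 0), circuitMatrix, ← Matrix.mulVec_mulVec,
            ptm_mulVec_ptmVec _ hρ.1.isHermitian]
          ring

/-- The root mean square error of Monte Carlo channel inversion, for labels in any finite type. -/
theorem qem_error_bound {Ω : Type*} [MeasurableSpace Ω] (P : Measure Ω) [IsProbabilityMeasure P]
    {n NG : ℕ} {ι : Type*} [Fintype ι] [MeasurableSpace ι] [MeasurableSingletonClass ι]
    {M : Op n} (hM : M.IsHermitian) (hM1 : ∀ a, hM.eigenvalues a ∈ Set.Icc (-1 : ℝ) 1)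
    {U : Fin NG → Op n} (hU : ∀ k, U k ∈ Matrix.unitaryGroup (Fin n → Fin 2) ℂ)
    {Ns : ℝ} (hNs : 0 < Ns) {N : Fin NG → ℕ}
    {O : ι → SuperOp n} (hO : ∀ l, IsCP (O l) ∧ IsTraceNonincreasing (O l))
    {C : Fin NG → SuperOp n} (hC : ∀ k, IsCPTP (C k)) {α : Fin NG → ι → ℝ}
    (hinv : ∀ k, (∑ l, (α k l : ℂ) • O l) ∘ₗ C k = LinearMap.id)
    (hN : ∀ k, Ns * l1 (α k) ^ 2 ≤ N k) {ℓ : ∀ k, Fin (N k) → Ω → ι} (hℓ : IsMonteCarlo P α N ℓ) :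
    Integrable (fun ω => (qemResult M U C O α (fun k i => ℓ k i ω) - idealResult M U) ^ 2) P ∧
      Real.sqrt (∫ ω, (qemResult M U C O α (fun k i => ℓ k i ω) - idealResult M U) ^ 2 ∂P) ≤
        (2 : ℝ) ^ ((n : ℝ) / 2) * Real.sqrt (Real.exp (2 * NG / Ns) - 1) := by
  -- If `α k` vanished, the inverse would be the zero map, yet it must recover the identity
  -- operator. This also forces `N k` to be positive.
  have hα : ∀ k, l1 (α k) ≠ 0 := fun k h => by
    have h0 : ∀ l, α k l = 0 := fun l =>
      abs_eq_zero.1 ((Finset.sum_eq_zero_iff_of_nonneg fun _ _ => abs_nonneg _).1 h l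
        (Finset.mem_univ l))
    have h1 := LinearMap.congr_fun (hinv k) 1
    simp [h0] at h1
  have hNpos : ∀ k, (0 : ℝ) < N k := fun k =>
    lt_of_lt_of_le (mul_pos hNs (pow_pos ((l1_nonneg _).lt_of_ne' (hα k)) 2)) (hN k)
  have hb : ∀ k, l1 (α k) ^ 2 / N k ≤ 1 / Ns := fun k => by
    rw [div_le_div_iff₀ (hNpos k) hNs]
    linarith [hN k]
  have hmain := sum_sampled_sq_le hM hM1 hU hO hC hinv hα (fun k => Nat.cast_ne_zero.1 (hNpos k).ne')
    (by positivity : (0 : ℝ) ≤ 1 / Ns) hb (isSubstate_initState n) (idealResult M U)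
  obtain ⟨hint, heq⟩ := hℓ.integrable_and_integral_eq
    fun s => (qemResult M U C O α s - idealResult M U) ^ 2
  refine ⟨hint, ?_⟩
  rw [heq]
  simp only [qemResult, stateVec_last]
  have hideal : ptmVec M ⬝ᵥ (circuitMatrix (fun k => ptm (conj (U k))) *ᵥ ptmVec (initState n)) =
      idealResult M U := by rw [idealResult, stateVec_last]
  rw [hideal, sub_self, zero_pow two_ne_zero, zero_add] at hmain
  -- The factor `2` in the exponent and the prefactor `2 ^ (n / 2) ≥ 1` are pure slack.
  have hexp : (1 + 1 / Ns) ^ NG ≤ Real.exp (2 * NG / Ns) :=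
    calc (1 + 1 / Ns) ^ NG ≤ Real.exp (1 / Ns) ^ NG :=
          pow_le_pow_left₀ (by positivity) (by linarith [Real.add_one_le_exp (1 / Ns)]) _
      _ = Real.exp (NG / Ns) := by rw [← Real.exp_nat_mul]; ring_nf
      _ ≤ Real.exp (2 * NG / Ns) := Real.exp_le_exp.2 (by
          gcongr
          linarith [(Nat.cast_nonneg NG : (0 : ℝ) ≤ NG)])
  calc _ ≤ Real.sqrt (Real.exp (2 * NG / Ns) - 1) := Real.sqrt_le_sqrt (by linarith)
    _ ≤ _ := le_mul_of_one_le_left (Real.sqrt_nonneg _)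
        (Real.one_le_rpow one_le_two (by positivity))

/-! ### Pauli channels -/

lemma sum_hadamard1 (i j : Fin 4) :
    ∑ k : Fin 4, (if i = 0 ∨ k = 0 ∨ i = k then (1 : ℝ) else -1) *
      (if k = 0 ∨ j = 0 ∨ k = j then (1 : ℝ) else -1) = if i = j then 4 else 0 := by
  fin_cases i <;> fin_cases j <;> simp [Fin.sum_univ_four] <;> norm_num

/-- `hadamard n` is the `n`-fold tensor power of a `4 × 4` sign matrix with orthogonal rows of
squared length `4`. -/
lemma hadamard_mul_self (n : ℕ) : hadamard n * hadamard n = (4 : ℝ) ^ n • 1 := by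
  ext i j
  simp only [Matrix.mul_apply, hadamard, Matrix.of_apply, ← Finset.prod_mul_distrib]
  rw [prod_sum_fin fun q k => (if i q = 0 ∨ k = 0 ∨ i q = k then (1 : ℝ) else -1) *
      (if k = 0 ∨ j q = 0 ∨ k = j q then (1 : ℝ) else -1)]
  simp only [sum_hadamard1, Finset.prod_ite_zero, Finset.prod_const, Finset.card_univ,
    Fintype.card_fin, Finset.mem_univ, true_implies, Matrix.smul_apply, Matrix.one_apply,
    funext_iff, smul_eq_mul]
  split_ifs <;> simp

lemma hadamard_comm {n : ℕ} (i j : PauliIdx n) : hadamard n i j = hadamard n j i := by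
  simp only [hadamard, Matrix.of_apply]
  refine Finset.prod_congr rfl fun q _ => ?_
  congr 1
  rw [eq_comm (a := i q) (b := j q), or_left_comm]

/-- Conjugating `S_j` by `S_i` only produces the commutation sign, so all such combinations are
simultaneously diagonal in the Pauli basis. -/
lemma sum_smul_conj_pauli {n : ℕ} (α : PauliIdx n → ℝ) (j : PauliIdx n) :
    (∑ i, (α i : ℂ) • conj (pauli i)) (pauli j) = ((hadamard n *ᵥ α) j : ℂ) • pauli j := by
  simp only [LinearMap.sum_apply, LinearMap.smul_apply, conj, LinearMap.coe_mk, AddHom.coe_mk,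
    (pauli_isHermitian _).eq, pauli_conj, smul_smul, ← Finset.sum_smul, Matrix.mulVec, dotProduct,
    Complex.ofReal_sum, Complex.ofReal_mul]
  congr 1
  exact Finset.sum_congr rfl fun i _ => by rw [hadamard_comm, mul_comm]

lemma hadamard_mulVec_pauliQuasiProb {n : ℕ} (q : PauliIdx n → ℝ) (j : PauliIdx n) :
    (hadamard n *ᵥ pauliQuasiProb q) j = 1 / (hadamard n *ᵥ q) j := by
  rw [pauliQuasiProb, Matrix.mulVec_smul, Matrix.mulVec_mulVec, hadamard_mul_self,
    Matrix.smul_mulVec, Matrix.one_mulVec, smul_smul, one_div_mul_cancel (by positivity), one_smul]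

lemma sum_pauliQuasiProb_comp_pauliChannel {n : ℕ} {q : PauliIdx n → ℝ}
    (hq : ∀ i, (hadamard n *ᵥ q) i ≠ 0) :
    (∑ i, (pauliQuasiProb q i : ℂ) • conj (pauli i)) ∘ₗ pauliChannel q = LinearMap.id := by
  refine superOp_ext fun j => ?_
  rw [LinearMap.comp_apply, pauliChannel, sum_smul_conj_pauli, map_smul, sum_smul_conj_pauli,
    hadamard_mulVec_pauliQuasiProb, smul_smul, ← Complex.ofReal_mul, mul_one_div_cancel (hq j),
    Complex.ofReal_one, one_smul, LinearMap.id_apply]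

lemma pauli_mem_unitaryGroup {n : ℕ} (i : PauliIdx n) :
    pauli i ∈ Matrix.unitaryGroup (Fin n → Fin 2) ℂ := by
  rw [Matrix.mem_unitaryGroup_iff, Matrix.star_eq_conjTranspose, (pauli_isHermitian i).eq,
    pauli_mul_self]

lemma isCPTP_pauliChannel {n : ℕ} {q : PauliIdx n → ℝ} (hq : ∀ i, 0 ≤ q i) (hq1 : ∑ i, q i = 1) :
    IsCPTP (pauliChannel q) := by
  have hsq : ∀ i, Real.sqrt (q i) * Real.sqrt (q i) = q i := fun i => Real.mul_self_sqrt (hq i)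
  let e := (Fintype.equivFin (PauliIdx n)).symm
  -- The Kraus operators are `√(q_i) S_i`, reindexed by `e` since `IsCPTP` asks for labels in some
  -- `Fin m`.
  refine ⟨_, fun k => (Real.sqrt (q (e k)) : ℂ) • pauli (e k), fun ρ => ?_, ?_⟩
  · rw [e.sum_comp fun i => ((Real.sqrt (q i) : ℂ) • pauli i) * ρ * ((Real.sqrt (q i) : ℂ) • pauli i)ᴴ]
    simp [pauliChannel, conj, smul_smul, hsq]
  · rw [e.sum_comp fun i => ((Real.sqrt (q i) : ℂ) • pauli i)ᴴ * ((Real.sqrt (q i) : ℂ) • pauli i)]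
    simp [smul_smul, hsq, (pauli_isHermitian _).eq, pauli_mul_self, ← Finset.sum_smul, hq1]

end QEM

theorem proposition3 {Ω : Type*} [MeasurableSpace Ω] (P : MeasureTheory.Measure Ω)
    [MeasureTheory.IsProbabilityMeasure P] (n NG : ℕ)
    -- the observable, with eigenvalues in `[-1, 1]`
    (M : QEM.Op n) (hM : M.IsHermitian) (hM1 : ∀ a, hM.eigenvalues a ∈ Set.Icc (-1 : ℝ) 1)
    -- the ideal gates
    (U : Fin NG → QEM.Op n) (hU : ∀ k, U k ∈ Matrix.unitaryGroup (Fin n → Fin 2) ℂ)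
    -- the number of effective samples, and the actual number of samples for each gate
    (Ns : ℝ) (hNs : 0 < Ns) (N : Fin NG → ℕ) :
    -- general channels
    (∀ (L : ℕ) (O : Fin L → QEM.SuperOp n) (C : Fin NG → QEM.SuperOp n) (α : Fin NG → Fin L → ℝ)
        (ℓ : ∀ k, Fin (N k) → Ω → Fin L),
      (∀ l, QEM.IsCP (O l) ∧ QEM.IsTraceNonincreasing (O l)) →
      (∀ k, QEM.IsCPTP (C k)) →
      (∀ k, (∑ l, (α k l : ℂ) • O l) ∘ₗ C k = LinearMap.id) →
      (∀ k, Ns * QEM.l1 (α k) ^ 2 ≤ N k) →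
      QEM.IsMonteCarlo P α N ℓ →
      MeasureTheory.Integrable
        (fun ω => (QEM.qemResult M U C O α (fun k i => ℓ k i ω) - QEM.idealResult M U) ^ 2) P ∧
      Real.sqrt
          (∫ ω, (QEM.qemResult M U C O α (fun k i => ℓ k i ω) - QEM.idealResult M U) ^ 2 ∂P) ≤
        (2 : ℝ) ^ ((n : ℝ) / 2) * Real.sqrt (Real.exp (2 * NG / Ns) - 1)) ∧
    -- Pauli channels, inverted by means of the Pauli operators
    (∀ (q : Fin NG → QEM.PauliIdx n → ℝ) (ℓ : ∀ k, Fin (N k) → Ω → QEM.PauliIdx n),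
      (∀ k i, 0 ≤ q k i) → (∀ k, ∑ i, q k i = 1) →
      (∀ k i, (QEM.hadamard n).mulVec (q k) i ≠ 0) →
      (∀ k, Ns * QEM.l1 (QEM.pauliQuasiProb (q k)) ^ 2 ≤ N k) →
      QEM.IsMonteCarlo P (fun k => QEM.pauliQuasiProb (q k)) N ℓ →
      MeasureTheory.Integrable
        (fun ω => (QEM.qemResult M U (fun k => QEM.pauliChannel (q k))
          (fun i => QEM.conj (QEM.pauli i)) (fun k => QEM.pauliQuasiProb (q k))
          (fun k i => ℓ k i ω) - QEM.idealResult M U) ^ 2) P ∧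
      Real.sqrt
          (∫ ω, (QEM.qemResult M U (fun k => QEM.pauliChannel (q k))
            (fun i => QEM.conj (QEM.pauli i)) (fun k => QEM.pauliQuasiProb (q k))
            (fun k i => ℓ k i ω) - QEM.idealResult M U) ^ 2 ∂P) ≤
        (2 : ℝ) ^ ((n : ℝ) / 2) * Real.sqrt (Real.exp (2 * NG / Ns) - 1)) := by
  refine ⟨fun L O C α ℓ hO hC hinv hN hℓ =>
    QEM.qem_error_bound P hM hM1 hU hNs hO hC hinv hN hℓ, fun q ℓ hq hq1 hc hN hℓ =>
    QEM.qem_error_bound P hM hM1 hU hNs (fun i => ?_)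
      (fun k => QEM.isCPTP_pauliChannel (hq k) (hq1 k))
      (fun k => QEM.sum_pauliQuasiProb_comp_pauliChannel (hc k)) hN hℓ⟩
  have h := QEM.isCPTP_conj (QEM.pauli_mem_unitaryGroup i)
  exact ⟨h.isCP, h.isTraceNonincreasing⟩
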